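/- Let $G$ be a real Lie group (smooth, without boundary, modelled on a Banach space; in particular any finite-dimensional Lie group) with Lie algebra $\mathfrak g=T_1G$, and let $K\subseteq G$ be a subgroup such that the space of right cosets $G/K=\{Kg\mid g\in G\}$, with the quotient topology, is a smooth manifold for which the projection $\pi:G\to G/K$ is a submersion. Let $\mathfrak k=T_1K$ be the Lie algebra of $K$, i.e. the set of velocities at $1$ of smooth curves in $G$ through $1$ that stay in $K$. Let $A:\mathfrak g\to\mathfrak g^*$ be a continuous symmetric operator, let $E(v)=\frac12\langle v,Av\rangle$, and suppose that $\ker A=\mathfrak k$, or that $E\ge 0$. Let $E_G$ be the right-invariant form on $G$ obtained from $E$ by right translations: $E_G(v)=E(dR_{g^{-1}}v)$ for $v\in T_gG$. We say that $E_G$ descends to $G/K$ if $E_G=\pi^*B$ for some smooth field $B$ of (possibly degenerate) quadratic forms on the tangent spaces of $G/K$. (1) If $E_G$ descends to $G/K$, then $E$ vanishes on $\mathfrak k$ and is $\mathrm{Ad}$-invariant under $\mathfrak k$, that is, $\langle \mathrm{ad}_wv,Au\rangle=-\langle v,A(\mathrm{ad}_wu)\rangle$ for all $w\in\mathfrak k$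 and $u,v\in\mathfrak g$. (2) Conversely, if $K$ is connected, and $E$ vanishes on $\mathfrak k$ and is $\mathrm{Ad}$-invariant under $\mathfrak k$, then $E_G$ descends to $G/K$. (3) For every such $K$, connected or not, $E_G$ descends to $G/K$ if and only if $E$ vanishes on $\mathfrak k$ and is $\mathrm{Ad}$-invariant under $K$, that is, $\langle \mathrm{Ad}_kv,A(\mathrm{Ad}_ku)\rangle=\langle v,Au\rangle$ for all $k\in K$ and $u,v\in\mathfrak g$. -/

import Mathlib

open scoped Manifold ContDiff

namespace CosetForm

noncomputable section

/-- The space `G/K = {Kg | g ∈ G}` of right cosets, with the quotient topology. -/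
abbrev RightCosetSpace {G : Type*} [Group G] (K : Subgroup G) : Type _ :=
  Quotient (QuotientGroup.rightRel K)

/-- The projection `G → G/K`, `g ↦ Kg`. -/
def cosetProj {G : Type*} [Group G] (K : Subgroup G) (g : G) : RightCosetSpace K :=
  Quotient.mk _ g

section Group

variable {E : Type*} [NormedAddCommGroup E] [NormedSpace ℝ E]
  {H : Type*} [TopologicalSpace H] (I : ModelWithCorners ℝ E H)
  {G : Type*} [TopologicalSpace G] [ChartedSpace H G] [Group G]

/-- The differential at `g` of the right translation `x ↦ x g⁻¹`, as a map `T_g G → 𝔤 = T_1 G`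
(the target `T_{g g⁻¹} G` is `T_1 G`, because `g g⁻¹ = 1`). -/
def toIdentity (g : G) : TangentSpace I g →L[ℝ] GroupLieAlgebra I G :=
  mfderiv I I (fun x : G => x * g⁻¹) g

/-- The adjoint action `Ad_k : 𝔤 → 𝔤`: the differential at `1` of `x ↦ k x k⁻¹`
(the target `T_{k 1 k⁻¹} G` is `T_1 G`, because `k 1 k⁻¹ = 1`). -/
def Ad (k : G) : GroupLieAlgebra I G →L[ℝ] GroupLieAlgebra I G :=
  mfderiv I I (fun x : G => k * x * k⁻¹) (1 : G)

/-- The Lie algebra `𝔨 = T_1 K ⊆ 𝔤` of a subgroup `K`: the velocities at the identity of the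
smooth curves in `G` that pass through `1` at time `0` and stay in `K`. -/
def lieAlgebraOf (K : Subgroup G) : Set (GroupLieAlgebra I G) :=
  {v | ∃ γ : ℝ → G, ContMDiff 𝓘(ℝ, ℝ) I ∞ γ ∧ γ 0 = 1 ∧ (∀ t, γ t ∈ K) ∧
    v = (mfderiv 𝓘(ℝ, ℝ) I γ (0 : ℝ) : ℝ →L[ℝ] E) 1}

variable {I}

/-- The energy `E(v) = ½ ⟨v, A v⟩` of an inertia operator `A : 𝔤 → 𝔤*`. -/
def energy (A : GroupLieAlgebra I G →L[ℝ] GroupLieAlgebra I G →L[ℝ] ℝ)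
    (v : GroupLieAlgebra I G) : ℝ :=
  (1 / 2) * A v v

/-- The right-invariant form `E_G`: on `T_g G` it is the energy form on `𝔤`, moved to `g` by right
translation. -/
def rightInvariantForm (A : GroupLieAlgebra I G →L[ℝ] GroupLieAlgebra I G →L[ℝ] ℝ)
    (g : G) (v : TangentSpace I g) : ℝ :=
  energy A (toIdentity I g v)

/-- The energy form vanishes on `𝔨`. -/
def VanishesOn (A : GroupLieAlgebra I G →L[ℝ] GroupLieAlgebra I G →L[ℝ] ℝ)
    (𝔨 : Set (GroupLieAlgebra I G)) : Prop :=
  ∀ v ∈ 𝔨, energy A v = 0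

/-- `Ad`-invariance under the Lie algebra `𝔨`:
`⟨ad_w v, A u⟩ = - ⟨v, A (ad_w u)⟩` for `w ∈ 𝔨` and `u, v ∈ 𝔤`. -/
def IsAdInvariant (A : GroupLieAlgebra I G →L[ℝ] GroupLieAlgebra I G →L[ℝ] ℝ)
    (𝔨 : Set (GroupLieAlgebra I G)) : Prop :=
  ∀ w ∈ 𝔨, ∀ u v : GroupLieAlgebra I G, A u ⁅w, v⁆ = - A ⁅w, u⁆ v

/-- `Ad`-invariance under the group `K`: `⟨Ad_k v, A (Ad_k u)⟩ = ⟨v, A u⟩` for `k ∈ K` and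
`u, v ∈ 𝔤`. -/
def IsGroupAdInvariant (A : GroupLieAlgebra I G →L[ℝ] GroupLieAlgebra I G →L[ℝ] ℝ)
    (K : Subgroup G) : Prop :=
  ∀ k ∈ K, ∀ u v : GroupLieAlgebra I G, A (Ad I k u) (Ad I k v) = A u v

end Group

section Descent

variable {E : Type*} [NormedAddCommGroup E] [NormedSpace ℝ E]
  {H : Type*} [TopologicalSpace H] {I : ModelWithCorners ℝ E H}
  {G : Type*} [TopologicalSpace G] [ChartedSpace H G] [Group G]
  {F : Type*} [NormedAddCommGroup F] [NormedSpace ℝ F]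
  {H' : Type*} [TopologicalSpace H'] (J : ModelWithCorners ℝ F H')

/-- A field of quadratic forms `q` on the tangent spaces of `G` descends to the manifold `G/K`: it
is the pullback, under the projection `π : G → G/K`, of a smooth field of (continuous, possibly
degenerate) quadratic forms `x ↦ B x v v`, with `B x` bilinear and symmetric, on the tangent spaces
of `G/K`. -/
def Descends (K : Subgroup G) [ChartedSpace H' (RightCosetSpace K)]
    [IsManifold J ∞ (RightCosetSpace K)] (q : ∀ g : G, TangentSpace I g → ℝ) : Prop :=
  ∃ B : ∀ x : RightCosetSpace K, TangentSpace J x →L[ℝ] TangentSpace J x →L[ℝ] ℝ,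
    ContMDiff J (J.prod 𝓘(ℝ, F →L[ℝ] F →L[ℝ] ℝ)) ∞
      (fun x => Bundle.TotalSpace.mk' (F →L[ℝ] F →L[ℝ] ℝ)
        (E := fun x : RightCosetSpace K => TangentSpace J x →L[ℝ] TangentSpace J x →L[ℝ] ℝ)
        x (B x)) ∧
    (∀ x v w, B x v w = B x w v) ∧
    ∀ (g : G) (v : TangentSpace I g),
      q g v = B (cosetProj K g) (mfderiv I J (cosetProj K) g v) (mfderiv I J (cosetProj K) g v)

end Descent

end

end CosetForm

/-! Trivialize `TG` by right translations. The fibre of `π` through `g` is the coset `Kg`, so `ker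
dπ_g` is `𝔨` translated to `g`; and left translation by `k ∈ K`, which leaves `π` unchanged, acts in
this trivialization as `Ad_k`. The pullback of `A` to `T_g G` therefore depends only on images under
`dπ`, consistently over each fibre, as soon as `A` annihilates `𝔨` and is `Ad_K`-invariant
(`form_modelToIdentity_eq`). Vanishing of the energy on `𝔨` gives annihilation: this is immediate if
`ker A = 𝔨`, and otherwise an isotropic vector of a nonnegative symmetric form lies in its kernel.
Smoothness of the descended form comes from local sections of the submersion. Conversely, a form
that descends gives `0` on `ker dπ_1` and equal values at `v` and `dL_k v`; polarization then yields
`Ad_K`-invariance.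

The passage between `K` and `𝔨` rests on `d/dt Ad_{γ(t)} u = [w(t), Ad_{γ(t)} u]`, where `w(t)` is
the velocity of `γ` translated on the right to `1`; at `t = 0` this is `hasDerivAt_modelAd`.
Differentiating `A (Ad_γ u) (Ad_γ v)` along curves in `K` gives infinitesimal invariance, and
integrating gives invariance along such curves. Submersion charts join every element of `K` near `1`
to `1` by a smooth curve in `K`, so the stabilizer of `A` in `K` is an open subgroup, hence all of
`K` when `K` is connected. -/

namespace CosetForm

/-! ### Derivatives between model spaces and their smooth dependence on parameters -/

section Differential

variable {E : Type*} [NormedAddCommGroup E] [NormedSpace ℝ E]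
  {H : Type*} [TopologicalSpace H] {I : ModelWithCorners ℝ E H}
  {M : Type*} [TopologicalSpace M] [ChartedSpace H M]
  {E' : Type*} [NormedAddCommGroup E'] [NormedSpace ℝ E']
  {H' : Type*} [TopologicalSpace H'] {I' : ModelWithCorners ℝ E' H'}
  {M' : Type*} [TopologicalSpace M'] [ChartedSpace H' M']
  {E'' : Type*} [NormedAddCommGroup E''] [NormedSpace ℝ E'']
  {H'' : Type*} [TopologicalSpace H''] {I'' : ModelWithCorners ℝ E'' H''}
  {M'' : Type*} [TopologicalSpace M''] [ChartedSpace H'' M'']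

variable (I I') in
/-- The manifold derivative, seen as a map between the model vector spaces. -/
noncomputable def modelDeriv (f : M → M') (x : M) : E →L[ℝ] E' := mfderiv I I' f x

/-- With values in fixed model spaces, base points can be rewritten along equalities such as `k * 1
* k⁻¹ = 1` without transport between tangent spaces. -/
theorem modelDeriv_comp {g : M' → M''} {f : M → M'} (x : M)
    (hg : MDifferentiableAt I' I'' g (f x)) (hf : MDifferentiableAt I I' f x) :
    modelDeriv I I'' (fun y => g (f y)) x
      = (modelDeriv I' I'' g (f x)).comp (modelDeriv I I' f x) :=
  mfderiv_comp x hg hf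

theorem modelDeriv_comp_apply {g : M' → M''} {f : M → M'} (x : M)
    (hg : MDifferentiableAt I' I'' g (f x)) (hf : MDifferentiableAt I I' f x) (v : E) :
    modelDeriv I I'' (fun y => g (f y)) x v
      = modelDeriv I' I'' g (f x) (modelDeriv I I' f x v) := by
  rw [modelDeriv_comp x hg hf]; rfl

theorem modelDeriv_congr {f g : M → M'} {x : M} (h : f =ᶠ[nhds x] g) :
    modelDeriv I I' f x = modelDeriv I I' g x :=
  h.mfderiv_eq

theorem modelDeriv_id (x : M) : modelDeriv I I (fun y : M => y) x = ContinuousLinearMap.id ℝ E :=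
  mfderiv_id

theorem modelDeriv_const (c : M') (x : M) : modelDeriv I I' (fun _ : M => c) x = 0 :=
  mfderiv_const

theorem modelDeriv_eq_fderiv (f : E → E') (x : E) :
    modelDeriv 𝓘(ℝ, E) 𝓘(ℝ, E') f x = fderiv ℝ f x :=
  mfderiv_eq_fderiv

theorem HasFDerivAt.modelDeriv {f : E → E'} {x : E} {f' : E →L[ℝ] E'} (h : HasFDerivAt f f' x) :
    modelDeriv 𝓘(ℝ, E) 𝓘(ℝ, E') f x = f' := by
  rw [modelDeriv_eq_fderiv, h.fderiv]

/-- A target base point that does not move contributes the identity coordinate change; only the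
change of coordinates in the source survives. -/
theorem inTangentCoordinates_of_target_eq [IsManifold I 1 M] [IsManifold I' 1 M'] {N : Type*}
    (g : N → M) (g' : N → M') (φ : N → E →L[ℝ] E') {x₀ x : N}
    (hx : g x ∈ (chartAt H (g x₀)).source) (h : g' x = g' x₀) :
    inTangentCoordinates I I' g g' φ x₀ x = (φ x).comp
      ((tangentBundleCore I M).coordChange (achart H (g x₀)) (achart H (g x)) (g x)) := by
  rw [inTangentCoordinates_eq _ _ _ hx (by simp [h]), h]
  ext v
  simp only [ContinuousLinearMap.comp_apply]
  exact (tangentBundleCore I' M').coordChange_self _ _ (by simp) _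

/-- The derivative of a smooth family of maps, in a chart of the source. -/
theorem contMDiffAt_modelDeriv [IsManifold I 1 M] [IsManifold I' 1 M'] [IsManifold I'' 1 M'']
    {f : M'' → M → M'} {g : M'' → M} {n₀ : M''} {y₀ : M'}
    (hf : ContMDiffAt (I''.prod I) I' ∞ (Function.uncurry f) (n₀, g n₀))
    (hg : ContMDiffAt I'' I ∞ g n₀) (hfix : ∀ n, f n (g n) = y₀) :
    ContMDiffAt I'' 𝓘(ℝ, E →L[ℝ] E') ∞ (fun n => (modelDeriv I I' (f n) (g n)).comp
      ((tangentBundleCore I M).coordChange (achart H (g n₀)) (achart H (g n)) (g n))) n₀ := by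
  have h : ContMDiffAt I'' 𝓘(ℝ, E →L[ℝ] E') ∞ (inTangentCoordinates I I' g (fun n => f n (g n))
    (fun n => modelDeriv I I' (f n) (g n)) n₀) n₀ := ContMDiffAt.mfderiv f g hf hg (by simp)
  refine h.congr_of_eventuallyEq ?_
  filter_upwards [hg.continuousAt.preimage_mem_nhds
    ((chartAt H (g n₀)).open_source.mem_nhds (mem_chart_source H (g n₀)))] with n hn
  exact (inTangentCoordinates_of_target_eq (I := I) (I' := I') g (fun n => f n (g n))
    (fun n => modelDeriv I I' (f n) (g n)) hn ((hfix n).trans (hfix n₀).symm)).symm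

/-- The derivative at fixed points of a smooth family of maps depends smoothly on the parameter. -/
theorem contMDiffAt_modelDeriv_of_fixed [IsManifold I 1 M] [IsManifold I' 1 M']
    [IsManifold I'' 1 M'']
    {f : M'' → M → M'} {n₀ : M''} {x₀ : M} {y₀ : M'}
    (hf : ContMDiffAt (I''.prod I) I' ∞ (Function.uncurry f) (n₀, x₀))
    (hfix : ∀ n, f n x₀ = y₀) :
    ContMDiffAt I'' 𝓘(ℝ, E →L[ℝ] E') ∞ (fun n => modelDeriv I I' (f n) x₀) n₀ := by
  refine (contMDiffAt_modelDeriv (g := fun _ => x₀) hf contMDiffAt_const hfix).congr_of_eventuallyEq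
    (Filter.Eventually.of_forall fun n => ?_)
  ext v
  simp only [ContinuousLinearMap.comp_apply]
  congr 1
  exact ((tangentBundleCore I M).coordChange_self _ _ (by simp) _).symm

end Differential

/-! ### The adjoint action and the right trivialization -/

section Adjoint

variable {E : Type*} [NormedAddCommGroup E] [NormedSpace ℝ E]
  {H : Type*} [TopologicalSpace H] {I : ModelWithCorners ℝ E H}
  {G : Type*} [TopologicalSpace G] [ChartedSpace H G] [Group G]

variable (I) in
/-- `Ad k`, as an endomorphism of the model space. -/
noncomputable def modelAd (k : G) : E →L[ℝ] E := modelDeriv I I (fun x : G => k * x * k⁻¹) 1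

variable (I) in
/-- `toIdentity g`, as an endomorphism of the model space. -/
noncomputable def modelToIdentity (g : G) : E →L[ℝ] E := modelDeriv I I (fun x : G => x * g⁻¹) g

variable [LieGroup I ∞ G]

omit [LieGroup I ∞ G] in
theorem modelToIdentity_one : modelToIdentity I (1 : G) = ContinuousLinearMap.id ℝ E := by
  rw [modelToIdentity, ← modelDeriv_id (I := I) (1 : G)]
  congr 1
  ext x
  simp

theorem mdifferentiable_mul_left_right (a b : G) :
    MDifferentiable I I (fun x : G => a * x * b) :=
  ((contMDiff_mul_right (I := I) (n := ∞) (a := b)).comp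
    (contMDiff_mul_left (I := I) (n := ∞) (a := a))).mdifferentiable (by simp)

theorem mdifferentiable_mul_left (a : G) : MDifferentiable I I (fun x : G => a * x) :=
  (contMDiff_mul_left (I := I) (n := ∞) (a := a)).mdifferentiable (by simp)

theorem mdifferentiable_mul_right (a : G) : MDifferentiable I I (fun x : G => x * a) :=
  (contMDiff_mul_right (I := I) (n := ∞) (a := a)).mdifferentiable (by simp)

theorem modelAd_mul (k l : G) (v : E) : modelAd I (k * l) v = modelAd I k (modelAd I l v) := by
  have h := modelDeriv_comp_apply (I := I) (I' := I) (I'' := I) (g := fun x : G => k * x * k⁻¹)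
    (f := fun x : G => l * x * l⁻¹) 1 (mdifferentiable_mul_left_right _ _ _)
    (mdifferentiable_mul_left_right _ _ _) v
  simp only [mul_one, mul_inv_cancel] at h
  rw [modelAd, modelAd, modelAd, ← h]
  congr 2
  ext x
  group

omit [LieGroup I ∞ G] in
theorem modelAd_one (v : E) : modelAd I (1 : G) v = v := by
  have : modelAd I (1 : G) = ContinuousLinearMap.id ℝ E := by
    rw [modelAd, ← modelDeriv_id (I := I) (1 : G)]
    congr 1
    ext x
    simp
  simp [this]

/-- Both sides differentiate the same map, since `(k x) (k g)⁻¹ = k (x g⁻¹) k⁻¹`: in the right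
trivialization, left translation is the adjoint action. -/
theorem modelToIdentity_mul_left (k g : G) (v : E) :
    modelToIdentity I (k * g) (modelDeriv I I (fun x => k * x) g v)
      = modelAd I k (modelToIdentity I g v) := by
  have h1 := modelDeriv_comp_apply (I := I) (I' := I) (I'' := I)
    (g := fun x : G => x * (k * g)⁻¹)
    (f := fun x : G => k * x) g (mdifferentiable_mul_right _ _) (mdifferentiable_mul_left _ _) v
  have h2 := modelDeriv_comp_apply (I := I) (I' := I) (I'' := I) (g := fun x : G => k * x * k⁻¹)
    (f := fun x : G => x * g⁻¹) g (mdifferentiable_mul_left_right _ _ _)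
    (mdifferentiable_mul_right _ _) v
  simp only [mul_inv_cancel] at h2
  rw [modelToIdentity, modelAd, modelToIdentity, ← h1, ← h2]
  congr 2
  ext x
  group

/-- If `γ` passes through `g` at time `t`, the velocity of `s ↦ γ s * g⁻¹` at `t` is the velocity
of `γ` moved to the identity. -/
theorem modelToIdentity_velocity {γ : ℝ → G} {t : ℝ}
    (hγ : MDifferentiableAt 𝓘(ℝ, ℝ) I γ t) :
    modelDeriv 𝓘(ℝ, ℝ) I (fun s => γ s * (γ t)⁻¹) t 1
      = modelToIdentity I (γ t) (modelDeriv 𝓘(ℝ, ℝ) I γ t 1) :=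
  modelDeriv_comp_apply (I'' := I) (g := fun x : G => x * (γ t)⁻¹) t
    (mdifferentiable_mul_right _ _) hγ 1

end Adjoint

/-! ### Local sections of a submersion -/

section Submersion

variable {E : Type*} [NormedAddCommGroup E] [NormedSpace ℝ E]
  {H : Type*} [TopologicalSpace H] {I : ModelWithCorners ℝ E H}
  {M : Type*} [TopologicalSpace M] [ChartedSpace H M]
  {F : Type*} [NormedAddCommGroup F] [NormedSpace ℝ F]
  {H' : Type*} [TopologicalSpace H'] {J : ModelWithCorners ℝ F H'}
  {N : Type*} [TopologicalSpace N] [ChartedSpace H' N]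

theorem contMDiffAt_extend_symm [I.Boundaryless] {φ : OpenPartialHomeomorph M H}
    (hφ : φ ∈ IsManifold.maximalAtlas I ∞ M) {y : E} (hy : y ∈ (φ.extend I).target) :
    ContMDiffAt 𝓘(ℝ, E) I ∞ (φ.extend I).symm y := by
  refine (contMDiffOn_extend_symm hφ).contMDiffAt ?_
  convert! (φ.isOpen_extend_target (I := I)).mem_nhds hy
  rw [φ.extend_target']

/-- A submersion has a smooth local section through every point. -/
theorem exists_local_section [I.Boundaryless] [J.Boundaryless] {p : M → N} {g : M}
    (hp : Manifold.IsSubmersionAt I J ∞ p g) :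
    ∃ s : N → M, ContMDiffAt J I ∞ s (p g) ∧ s (p g) = g ∧ ∀ᶠ y in nhds (p g), p (s y) = y := by
  obtain ⟨C, _, _, ⟨φ, ψ, hg, hpg, hφ, hψ, hsub, e, he⟩⟩ := hp
  have hgt : φ.extend I g ∈ (φ.extend I).target := (φ.extend I).map_source (by simpa using hg)
  have htn : (φ.extend I).target ∈ nhds (φ.extend I g) :=
    (φ.isOpen_extend_target (I := I)).mem_nhds hgt
  have heg : (e (φ.extend I g)).1 = ψ.extend J (p g) := by
    have := he hgt
    simp only [Function.comp_apply] at this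
    rw [← this, φ.extend_left_inv hg]
  -- In submersion charts `p` is the first projection: let the base coordinate vary and freeze the
  -- complementary one at its value at `g`.
  let c : N → E := fun y => e.symm (ψ.extend J y, (e (φ.extend I g)).2)
  have hcg : c (p g) = φ.extend I g := by
    simp only [c, ← heg, Prod.mk.eta]
    simp
  have hc : ContMDiffAt J 𝓘(ℝ, E) ∞ c (p g) := by
    have h1 : ContMDiffAt J 𝓘(ℝ, F) ∞ (ψ.extend J) (p g) :=
      (OpenPartialHomeomorph.contMDiffOn_extend hψ).contMDiffAt (ψ.open_source.mem_nhds hpg)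
    have h2 : ContDiff ℝ ∞ (fun u : F => e.symm (u, (e (φ.extend I g)).2)) :=
      e.symm.contDiff.comp (contDiff_id.prodMk contDiff_const)
    exact h2.contMDiff.contMDiffAt.comp (p g) h1
  have hφs : ContMDiffAt 𝓘(ℝ, E) I ∞ (φ.extend I).symm (c (p g)) :=
    contMDiffAt_extend_symm hφ (hcg ▸ hgt)
  refine ⟨fun y => (φ.extend I).symm (c y), hφs.comp _ hc, ?_, ?_⟩
  · simp only [hcg]
    exact φ.extend_left_inv hg
  · have h1 : c ⁻¹' (φ.extend I).target ∈ nhds (p g) :=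
      hc.continuousAt.preimage_mem_nhds (by rwa [hcg])
    filter_upwards [h1, ψ.open_source.mem_nhds hpg] with y hy hy'
    have h2 := he hy
    simp only [Function.comp_apply, c, ContinuousLinearEquiv.apply_symm_apply] at h2
    refine (ψ.extend J).injOn ?_ (by simpa using hy') h2
    rw [ψ.extend_source]
    apply hsub
    have := (φ.extend I).map_target hy
    rwa [φ.extend_source] at this

end Submersion

/-! ### Smooth curves inside the fibres of a submersion -/

section FibreCurves

variable {E : Type*} [NormedAddCommGroup E] [NormedSpace ℝ E]
  {H : Type*} [TopologicalSpace H] {I : ModelWithCorners ℝ E H}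
  {M : Type*} [TopologicalSpace M] [ChartedSpace H M]
  {F : Type*} [NormedAddCommGroup F] [NormedSpace ℝ F]
  {H' : Type*} [TopologicalSpace H'] {J : ModelWithCorners ℝ F H'}
  {N : Type*} [TopologicalSpace N] [ChartedSpace H' N]

/-- A line in a chart, reparametrized so that it stays in the target. -/
theorem contMDiff_chart_line [I.Boundaryless] {φ : OpenPartialHomeomorph M H}
    (hφ : φ ∈ IsManifold.maximalAtlas I ∞ M) {a w : E} {η : ℝ → ℝ} (hη : ContDiff ℝ ∞ η)
    (ht : ∀ t, a + η t • w ∈ (φ.extend I).target) :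
    ContMDiff 𝓘(ℝ, ℝ) I ∞ (fun t => (φ.extend I).symm (a + η t • w)) := fun t =>
  (contMDiffAt_extend_symm hφ (ht t)).comp t
    (contDiff_const.add (hη.smul contDiff_const)).contMDiff.contMDiffAt

omit [ChartedSpace H M] [ChartedSpace H' N] in
/-- A chart line in the direction of the fibre stays in the fibre. -/
theorem proj_chart_line {C : Type*} [NormedAddCommGroup C] [NormedSpace ℝ C] {p : M → N} {g : M}
    {φ : OpenPartialHomeomorph M H} {ψ : OpenPartialHomeomorph N H'} {e : E ≃L[ℝ] (F × C)}
    (hg : g ∈ φ.source) (hsub : φ.source ⊆ p ⁻¹' ψ.source)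
    (he : Set.EqOn (ψ.extend J ∘ p ∘ (φ.extend I).symm) (Prod.fst ∘ e) (φ.extend I).target)
    {w : E} (hw : (e w).1 = 0) (h : φ.extend I g + w ∈ (φ.extend I).target) :
    p ((φ.extend I).symm (φ.extend I g + w)) = p g := by
  have hgt : φ.extend I g ∈ (φ.extend I).target := (φ.extend I).map_source (by simpa using hg)
  have h1 := he h
  have h2 := he hgt
  simp only [Function.comp_apply, map_add, Prod.fst_add, hw, add_zero] at h1 h2
  rw [φ.extend_left_inv hg] at h2
  refine (ψ.extend J).injOn ?_ (by simpa using hsub hg) (h1.trans h2.symm)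
  rw [ψ.extend_source]
  apply hsub
  have := (φ.extend I).map_target h
  rwa [φ.extend_source] at this

/-- Vectors killed by the differential of a submersion are velocities of curves in the fibre. -/
theorem exists_fibre_curve_of_modelDeriv_eq_zero [I.Boundaryless] {p : M → N} {g : M}
    (hp : Manifold.IsSubmersionAt I J ∞ p g) {v : E} (hv : modelDeriv I J p g v = 0) :
    ∃ γ : ℝ → M, ContMDiff 𝓘(ℝ, ℝ) I ∞ γ ∧ γ 0 = g ∧ (∀ t, p (γ t) = p g) ∧
      modelDeriv 𝓘(ℝ, ℝ) I γ 0 1 = v := by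
  have hpd : MDifferentiableAt I J p g := hp.contMDiffAt.mdifferentiableAt (by simp)
  obtain ⟨C, _, _, ⟨φ, ψ, hg, hpg, hφ, hψ, hsub, e, he⟩⟩ := hp
  have hgt : φ.extend I g ∈ (φ.extend I).target := (φ.extend I).map_source (by simpa using hg)
  have hφd : MDifferentiableAt I 𝓘(ℝ, E) (φ.extend I) g :=
    ((OpenPartialHomeomorph.contMDiffOn_extend hφ).contMDiffAt
      (φ.open_source.mem_nhds hg)).mdifferentiableAt (by simp)
  have hψd : MDifferentiableAt J 𝓘(ℝ, F) (ψ.extend J) (p g) :=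
    ((OpenPartialHomeomorph.contMDiffOn_extend hψ).contMDiffAt
      (ψ.open_source.mem_nhds hpg)).mdifferentiableAt (by simp)
  have hsd := (contMDiffAt_extend_symm hφ hgt).mdifferentiableAt (by simp)
  set w : E := modelDeriv I 𝓘(ℝ, E) (φ.extend I) g v with hwdef
  have hw : (e w).1 = 0 := by
    let L : E →L[ℝ] F := (ContinuousLinearMap.fst ℝ F C).comp (e : E →L[ℝ] F × C)
    have h1 := modelDeriv_comp_apply g hψd hpd v
    have h2 := modelDeriv_comp_apply (I'' := 𝓘(ℝ, F)) (g := L) g L.differentiableAt.mdifferentiableAt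
      hφd v
    rw [hv, map_zero] at h1
    rw [modelDeriv_eq_fderiv, L.fderiv, ← hwdef] at h2
    change _ = (e w).1 at h2
    rw [← h2, ← h1]
    congr 1
    apply modelDeriv_congr
    filter_upwards [φ.open_source.mem_nhds hg] with x hx
    have := he ((φ.extend I).map_source (by simpa using hx))
    simp only [Function.comp_apply] at this
    rw [φ.extend_left_inv hx] at this
    exact this.symm
  have hsw : modelDeriv 𝓘(ℝ, E) I (φ.extend I).symm (φ.extend I g) w = v := by
    rw [hwdef, ← modelDeriv_comp_apply g hsd hφd]
    rw [modelDeriv_congr (g := fun x => x), modelDeriv_id, ContinuousLinearMap.id_apply]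
    filter_upwards [φ.open_source.mem_nhds hg] with x hx
    exact φ.extend_left_inv hx
  obtain ⟨ε, hε, hball⟩ : ∃ ε > 0, ∀ r : ℝ, |r| ≤ ε →
      φ.extend I g + r • w ∈ (φ.extend I).target := by
    have hc : Continuous (fun r : ℝ => φ.extend I g + r • w) := by fun_prop
    have := hc.continuousAt.preimage_mem_nhds (x := 0)
      ((φ.isOpen_extend_target (I := I)).mem_nhds (by simpa using hgt))
    obtain ⟨ε, hε, h⟩ := Metric.nhds_basis_closedBall.mem_iff.1 this
    exact ⟨ε, hε, fun r hr => h (by simpa using hr)⟩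
  -- The curve must exist for all times. The parameter `ε sin (t / ε)` has modulus at most `ε` and
  -- derivative `1` at `0`, so the line stays in the chart and keeps its initial velocity.
  have ht : ∀ t : ℝ, φ.extend I g + (ε * Real.sin (t / ε)) • w ∈ (φ.extend I).target := fun t =>
    hball _ (by
      rw [abs_mul, abs_of_pos hε]
      exact mul_le_of_le_one_right hε.le (Real.abs_sin_le_one _))
  have hη : ContDiff ℝ ∞ (fun t : ℝ => ε * Real.sin (t / ε)) := by fun_prop
  refine ⟨_, contMDiff_chart_line hφ hη ht, ?_, fun t => ?_, ?_⟩
  · simpa using φ.extend_left_inv (I := I) hg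
  · exact proj_chart_line hg hsub he (by simp [hw]) (ht t)
  · have hd : HasDerivAt (fun t : ℝ => φ.extend I g + (ε * Real.sin (t / ε)) • w) w 0 := by
      have h1 : HasDerivAt (fun t : ℝ => ε * Real.sin (t / ε)) 1 0 := by
        have := (((hasDerivAt_id (0 : ℝ)).div_const ε).sin).const_mul ε
        convert! this using 1
        simp [hε.ne']
      simpa using (h1.smul_const w).const_add (φ.extend I g)
    have h0 : φ.extend I g + (ε * Real.sin (0 / ε)) • w = φ.extend I g := by simp
    have h3 := modelDeriv_comp_apply (I := 𝓘(ℝ, ℝ)) (I' := 𝓘(ℝ, E)) (I'' := I)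
      (g := (φ.extend I).symm)
      (f := fun t : ℝ => φ.extend I g + (ε * Real.sin (t / ε)) • w) 0 (by rwa [h0])
      hd.differentiableAt.mdifferentiableAt 1
    rw [h3, h0, modelDeriv_eq_fderiv, hd.hasFDerivAt.fderiv]
    simpa using hsw

/-- Points of a fibre of a submersion near a given one are joined to it by a curve in the fibre. -/
theorem eventually_exists_fibre_curve [I.Boundaryless] {p : M → N} {g : M}
    (hp : Manifold.IsSubmersionAt I J ∞ p g) :
    ∀ᶠ h in nhds g, p h = p g → ∃ γ : ℝ → M, ContMDiff 𝓘(ℝ, ℝ) I ∞ γ ∧ γ 0 = g ∧ γ 1 = h ∧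
      ∀ t, p (γ t) = p g := by
  obtain ⟨C, _, _, ⟨φ, ψ, hg, hpg, hφ, hψ, hsub, e, he⟩⟩ := hp
  have hgt : φ.extend I g ∈ (φ.extend I).target := (φ.extend I).map_source (by simpa using hg)
  obtain ⟨ε, hε, hball⟩ := Metric.mem_nhds_iff.1 ((φ.isOpen_extend_target (I := I)).mem_nhds hgt)
  have hc : ContinuousAt (φ.extend I) g := φ.continuousAt_extend hg
  filter_upwards [φ.open_source.mem_nhds hg, hc.preimage_mem_nhds (Metric.ball_mem_nhds _ hε)]
    with h hh hhb hph
  -- The smooth transition takes values in `[0, 1]`, with `0` at `t = 0` and `1` at `t = 1`, so the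
  -- curve runs along a segment inside a convex ball. The segment is vertical because both ends have
  -- the same base coordinate.
  have ht : ∀ t : ℝ, φ.extend I g + Real.smoothTransition t • (φ.extend I h - φ.extend I g) ∈
      (φ.extend I).target := fun t =>
    hball ((convex_ball (φ.extend I g) ε).add_smul_sub_mem (Metric.mem_ball_self hε) hhb
      ⟨Real.smoothTransition.nonneg t, Real.smoothTransition.le_one t⟩)
  refine ⟨_, contMDiff_chart_line hφ Real.smoothTransition.contDiff ht, ?_, ?_, fun t => ?_⟩
  · simpa using φ.extend_left_inv (I := I) hg
  · simpa using φ.extend_left_inv (I := I) hh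
  · refine proj_chart_line hg hsub he ?_ (ht t)
    have h1 := he ((φ.extend I).map_source (by simpa using hh))
    have h2 := he hgt
    simp only [Function.comp_apply] at h1 h2
    rw [φ.extend_left_inv hh, hph] at h1
    rw [φ.extend_left_inv hg] at h2
    rw [map_smul, map_sub, Prod.smul_fst, Prod.fst_sub, ← h1, ← h2, sub_self, smul_zero]

end FibreCurves

/-! ### The Lie bracket as the derivative of the adjoint representation -/

section Bracket

open VectorField

variable {E : Type*} [NormedAddCommGroup E] [NormedSpace ℝ E]
  {H : Type*} [TopologicalSpace H] {I : ModelWithCorners ℝ E H}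
  {G : Type*} [TopologicalSpace G] [ChartedSpace H G] [Group G]

variable (I G) in
/-- The multiplication of `G`, read in the preferred chart at the identity. -/
noncomputable def chartMul (p : E × E) : E :=
  extChartAt I (1 : G) ((extChartAt I (1 : G)).symm p.1 * (extChartAt I (1 : G)).symm p.2)

variable (I G) in
/-- The coordinate of the identity in the preferred chart. -/
noncomputable def chartOne : E := extChartAt I (1 : G) 1

theorem symm_chartOne : (extChartAt I (1 : G)).symm (chartOne I G) = 1 :=
  extChartAt_to_inv (1 : G)

section Boundaryless

variable [I.Boundaryless]

theorem chartTarget_mem_nhds : (extChartAt I (1 : G)).target ∈ nhds (chartOne I G) :=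
  extChartAt_target_mem_nhds (1 : G)

variable [LieGroup I ∞ G]

theorem contMDiffAt_extChartAt_symm_of_mem {y : E} (hy : y ∈ (extChartAt I (1 : G)).target) :
    ContMDiffAt 𝓘(ℝ, E) I ∞ (extChartAt I (1 : G)).symm y :=
  contMDiffAt_extend_symm (IsManifold.chart_mem_maximalAtlas 1) hy

omit [I.Boundaryless] in
theorem contMDiffAt_extChartAt_of_mem {x : G} (hx : x ∈ (chartAt H (1 : G)).source) :
    ContMDiffAt I 𝓘(ℝ, E) ∞ (extChartAt I (1 : G)) x :=
  contMDiffAt_extChartAt' hx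

theorem contDiffAt_chartMul :
    ContDiffAt ℝ ∞ (chartMul I G) (chartOne I G, chartOne I G) := by
  rw [← contMDiffAt_iff_contDiffAt]
  have h := contMDiffAt_extChartAt_symm_of_mem (mem_of_mem_nhds (chartTarget_mem_nhds (I := I)
    (G := G)))
  have h1 : ContMDiffAt 𝓘(ℝ, E × E) I ∞ (fun p : E × E => (extChartAt I (1 : G)).symm p.1)
      (chartOne I G, chartOne I G) :=
    ContMDiffAt.comp (x := ((chartOne I G, chartOne I G) : E × E)) h
      contDiff_fst.contMDiff.contMDiffAt
  have h2 : ContMDiffAt 𝓘(ℝ, E × E) I ∞ (fun p : E × E => (extChartAt I (1 : G)).symm p.2)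
      (chartOne I G, chartOne I G) :=
    ContMDiffAt.comp (x := ((chartOne I G, chartOne I G) : E × E)) h
      contDiff_snd.contMDiff.contMDiffAt
  refine ContMDiffAt.comp _ (contMDiffAt_extChartAt_of_mem ?_) (h1.mul h2)
  rw [symm_chartOne, mul_one]
  exact mem_chart_source H 1

omit [I.Boundaryless] in
theorem modelDeriv_extChartAt_one :
    modelDeriv I 𝓘(ℝ, E) (extChartAt I (1 : G)) 1 = ContinuousLinearMap.id ℝ E :=
  have : IsManifold I 1 G := .of_le (n := ∞) (by simp)
  mfderiv_extChartAt_self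

theorem modelDeriv_extChartAt_symm_one :
    modelDeriv 𝓘(ℝ, E) I (extChartAt I (1 : G)).symm (chartOne I G)
      = ContinuousLinearMap.id ℝ E := by
  have : IsManifold I 1 G := .of_le (n := ∞) (by simp)
  have h : mfderivWithin 𝓘(ℝ, E) I (extChartAt I (1 : G)).symm (Set.range I) (chartOne I G)
    = ContinuousLinearMap.id ℝ E := mfderivWithin_range_extChartAt_symm
  rwa [I.range_eq_univ, mfderivWithin_univ] at h

theorem eventually_differentiableAt_chartMul :
    ∀ᶠ p in nhds (chartOne I G, chartOne I G), DifferentiableAt ℝ (chartMul I G) p := by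
  have := (contDiffAt_chartMul (I := I) (G := G)).of_le (m := 1) (by simp)
  filter_upwards [this.eventually (by simp)] with p hp
  exact hp.differentiableAt (by simp)

omit [I.Boundaryless] [LieGroup I ∞ G] in
theorem continuousAt_prodMk_chartOne :
    ContinuousAt (fun y : E => (y, chartOne I G)) (chartOne I G) := by fun_prop

omit [I.Boundaryless] [LieGroup I ∞ G] in
theorem continuousAt_chartOne_prodMk :
    ContinuousAt (fun y : E => (chartOne I G, y)) (chartOne I G) := by fun_prop

/-- The inverse chart has the identity as its derivative at `chartOne`, so the partial derivative in
the second factor is the differential of a left translation, with a chart applied only in the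
target. -/
theorem fderiv_chartMul_left {y : E} (hy : y ∈ (extChartAt I (1 : G)).target)
    (hd : DifferentiableAt ℝ (chartMul I G) (y, chartOne I G)) (v : E) :
    fderiv ℝ (chartMul I G) (y, chartOne I G) (0, v)
      = modelDeriv I 𝓘(ℝ, E)
        (fun x => extChartAt I (1 : G) ((extChartAt I (1 : G)).symm y * x)) 1 v := by
  have hys : (extChartAt I (1 : G)).symm y ∈ (chartAt H (1 : G)).source := by
    simpa using (extChartAt I (1 : G)).map_target hy
  have h1 : HasFDerivAt (fun z => chartMul I G (y, z))
      ((fderiv ℝ (chartMul I G) (y, chartOne I G)).comp (ContinuousLinearMap.inr ℝ E E))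
      (chartOne I G) :=
    hd.hasFDerivAt.comp (chartOne I G) (hasFDerivAt_prodMk_right (𝕜 := ℝ) y (chartOne I G))
  have h2 := modelDeriv_comp_apply (I := 𝓘(ℝ, E)) (I' := I) (I'' := 𝓘(ℝ, E))
    (g := fun x => extChartAt I (1 : G) ((extChartAt I (1 : G)).symm y * x))
    (f := (extChartAt I (1 : G)).symm) (chartOne I G) ?_ ?_ v
  · rw [symm_chartOne, modelDeriv_extChartAt_symm_one] at h2
    exact ((DFunLike.congr_fun (HasFDerivAt.modelDeriv h1) v).symm.trans h2)
  · rw [symm_chartOne]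
    refine MDifferentiableAt.comp (I' := I) 1 ?_ (mdifferentiable_mul_left _ 1)
    exact (contMDiffAt_extChartAt_of_mem (by simpa using hys)).mdifferentiableAt (by simp)
  · exact (contMDiffAt_extChartAt_symm_of_mem
      (mem_of_mem_nhds chartTarget_mem_nhds)).mdifferentiableAt (by simp)

theorem fderiv_chartMul_right {y : E} (hy : y ∈ (extChartAt I (1 : G)).target)
    (hd : DifferentiableAt ℝ (chartMul I G) (chartOne I G, y)) (v : E) :
    fderiv ℝ (chartMul I G) (chartOne I G, y) (v, 0)
      = modelDeriv I 𝓘(ℝ, E)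
        (fun x => extChartAt I (1 : G) (x * (extChartAt I (1 : G)).symm y)) 1 v := by
  have hys : (extChartAt I (1 : G)).symm y ∈ (chartAt H (1 : G)).source := by
    simpa using (extChartAt I (1 : G)).map_target hy
  have h1 : HasFDerivAt (fun z => chartMul I G (z, y))
      ((fderiv ℝ (chartMul I G) (chartOne I G, y)).comp (ContinuousLinearMap.inl ℝ E E))
      (chartOne I G) :=
    HasFDerivAt.comp (g := chartMul I G) (chartOne I G) hd.hasFDerivAt
      (hasFDerivAt_prodMk_left (𝕜 := ℝ) (chartOne I G) y)
  have h2 := modelDeriv_comp_apply (I := 𝓘(ℝ, E)) (I' := I) (I'' := 𝓘(ℝ, E))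
    (g := fun x => extChartAt I (1 : G) (x * (extChartAt I (1 : G)).symm y))
    (f := (extChartAt I (1 : G)).symm) (chartOne I G) ?_ ?_ v
  · rw [symm_chartOne, modelDeriv_extChartAt_symm_one] at h2
    exact ((DFunLike.congr_fun (HasFDerivAt.modelDeriv h1) v).symm.trans h2)
  · rw [symm_chartOne]
    refine MDifferentiableAt.comp (I' := I) 1 ?_ (mdifferentiable_mul_right _ 1)
    exact (contMDiffAt_extChartAt_of_mem (by simpa using hys)).mdifferentiableAt (by simp)
  · exact (contMDiffAt_extChartAt_symm_of_mem
      (mem_of_mem_nhds chartTarget_mem_nhds)).mdifferentiableAt (by simp)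

/-- The relation `dR_k ∘ Ad_k = dL_k`, in the chart. -/
theorem eventually_fderiv_chartMul_modelAd :
    ∀ᶠ y in nhds (chartOne I G), ∀ v,
      fderiv ℝ (chartMul I G) (chartOne I G, y) (modelAd I ((extChartAt I (1 : G)).symm y) v, 0)
        = fderiv ℝ (chartMul I G) (y, chartOne I G) (0, v) := by
  filter_upwards [chartTarget_mem_nhds (I := I) (G := G),
    continuousAt_prodMk_chartOne.eventually eventually_differentiableAt_chartMul,
    continuousAt_chartOne_prodMk.eventually eventually_differentiableAt_chartMul]
    with y hy h1 h2 v
  rw [fderiv_chartMul_left hy h1, fderiv_chartMul_right hy h2]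
  have hks : (extChartAt I (1 : G)).symm y ∈ (chartAt H (1 : G)).source := by
    simpa using (extChartAt I (1 : G)).map_target hy
  set k := (extChartAt I (1 : G)).symm y
  have hd : MDifferentiableAt I 𝓘(ℝ, E) (fun x => extChartAt I (1 : G) (x * k)) 1 :=
    MDifferentiableAt.comp (I' := I) 1 ((contMDiffAt_extChartAt_of_mem
      (by simpa using hks)).mdifferentiableAt (by simp)) (mdifferentiable_mul_right _ 1)
  -- Chain rule for `(k x k⁻¹) k = k x`.
  have h3 := modelDeriv_comp_apply (I := I) (I' := I) (I'' := 𝓘(ℝ, E))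
    (g := fun x => extChartAt I (1 : G) (x * k)) (f := fun x : G => k * x * k⁻¹) 1
    (by simpa using hd) (mdifferentiable_mul_left_right _ _ 1) v
  simp only [mul_one, mul_inv_cancel, inv_mul_cancel_right] at h3
  exact h3.symm

variable (I G) in
/-- The left-invariant vector field through `v`, in the chart. -/
noncomputable def chartField (v : E) : E → E :=
  mpullbackWithin 𝓘(ℝ, E) I (extChartAt I (1 : G)).symm
    (mulInvariantVectorField (v : GroupLieAlgebra I G)) (Set.range I)

/-- Pulling back along the inverse chart applies the inverse of its differential, that is, the
differential of the chart; on `dL_k v` this gives the partial derivative of the product. -/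
theorem eventually_chartField (v : E) :
    chartField I G v =ᶠ[nhds (chartOne I G)]
      fun y => fderiv ℝ (chartMul I G) (y, chartOne I G) (0, v) := by
  filter_upwards [chartTarget_mem_nhds (I := I) (G := G),
    continuousAt_prodMk_chartOne.eventually eventually_differentiableAt_chartMul] with y hy h1
  have : IsManifold I 1 G := .of_le (n := ∞) (by simp)
  have hinv := ContinuousLinearMap.inverse_eq
    (mfderivWithin_extChartAt_symm_comp_mfderiv_extChartAt hy)
    (mfderiv_extChartAt_comp_mfderivWithin_extChartAt_symm hy)
  have hks : (extChartAt I (1 : G)).symm y ∈ (chartAt H (1 : G)).source := by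
    simpa using (extChartAt I (1 : G)).map_target hy
  have h2 : chartField I G v y =
      modelDeriv I 𝓘(ℝ, E) (extChartAt I (1 : G)) ((extChartAt I (1 : G)).symm y)
        (modelDeriv I I (fun x : G => (extChartAt I (1 : G)).symm y * x) 1 v) :=
    DFunLike.congr_fun hinv _
  have h3 := modelDeriv_comp_apply (I := I) (I' := I) (I'' := 𝓘(ℝ, E))
    (g := extChartAt I (1 : G)) (f := fun x : G => (extChartAt I (1 : G)).symm y * x) 1
    ((contMDiffAt_extChartAt_of_mem (by simpa using hks)).mdifferentiableAt (by simp))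
    (mdifferentiable_mul_left _ 1) v
  rw [fderiv_chartMul_left hy h1, h3, h2]
  simp only [mul_one]

theorem fderiv_chartMul_chartOne_left (v : E) :
    fderiv ℝ (chartMul I G) (chartOne I G, chartOne I G) (0, v) = v := by
  rw [fderiv_chartMul_left (mem_of_mem_nhds chartTarget_mem_nhds)
    eventually_differentiableAt_chartMul.self_of_nhds, symm_chartOne]
  simp only [one_mul]
  exact DFunLike.congr_fun modelDeriv_extChartAt_one v

theorem fderiv_chartMul_chartOne_right (v : E) :
    fderiv ℝ (chartMul I G) (chartOne I G, chartOne I G) (v, 0) = v := by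
  rw [fderiv_chartMul_right (mem_of_mem_nhds chartTarget_mem_nhds)
    eventually_differentiableAt_chartMul.self_of_nhds, symm_chartOne]
  simp only [mul_one]
  exact DFunLike.congr_fun modelDeriv_extChartAt_one v

theorem hasFDerivAt_fderiv_chartMul :
    HasFDerivAt (fderiv ℝ (chartMul I G))
      (fderiv ℝ (fderiv ℝ (chartMul I G)) (chartOne I G, chartOne I G))
      (chartOne I G, chartOne I G) :=
  (((contDiffAt_chartMul (I := I) (G := G)).fderiv_right (m := 1) (by norm_cast)).differentiableAt
    (by simp)).hasFDerivAt

variable (I G) in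
/-- The Lie bracket of the Lie algebra of `G`, on the model space. -/
noncomputable def modelBracket (w v : E) : E :=
  Bracket.bracket (L := GroupLieAlgebra I G) (M := GroupLieAlgebra I G) w v

theorem modelBracket_eq_lieBracket (w v : E) :
    modelBracket I G w v = lieBracket ℝ (chartField I G w) (chartField I G v) (chartOne I G) := by
  have h : modelBracket I G w v = (modelDeriv I 𝓘(ℝ, E) (extChartAt I (1 : G)) 1).inverse
      (lieBracketWithin ℝ (chartField I G w) (chartField I G v)
        ((extChartAt I (1 : G)).symm ⁻¹' Set.univ ∩ Set.range I) (chartOne I G)) := rfl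
  rw [h, modelDeriv_extChartAt_one, ContinuousLinearMap.inverse_id, I.range_eq_univ,
    Set.preimage_univ, Set.univ_inter, lieBracketWithin_univ, ContinuousLinearMap.id_apply]

theorem fderiv_chartField (u x : E) :
    fderiv ℝ (chartField I G u) (chartOne I G) x
      = fderiv ℝ (fderiv ℝ (chartMul I G)) (chartOne I G, chartOne I G) (x, 0) (0, u) := by
  have h1 : HasFDerivAt (fun y => fderiv ℝ (chartMul I G) (y, chartOne I G))
      ((fderiv ℝ (fderiv ℝ (chartMul I G)) (chartOne I G, chartOne I G)).comp
      (ContinuousLinearMap.inl ℝ E E)) (chartOne I G) :=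
    HasFDerivAt.comp (g := fderiv ℝ (chartMul I G)) (chartOne I G) hasFDerivAt_fderiv_chartMul
      (hasFDerivAt_prodMk_left (𝕜 := ℝ) (chartOne I G) (chartOne I G))
  rw [(eventually_chartField u).fderiv_eq]
  exact DFunLike.congr_fun
    ((ContinuousLinearMap.apply ℝ E ((0, u) : E × E)).hasFDerivAt.comp _ h1).fderiv x

/-- Left-invariant fields are first partial derivatives of the product, so their bracket
antisymmetrizes its mixed second derivative. This is the form that the derivative of `Ad` is matched
with. -/
theorem modelBracket_eq (w v : E) :
    modelBracket I G w v =
      fderiv ℝ (fderiv ℝ (chartMul I G)) (chartOne I G, chartOne I G) (w, 0) (0, v)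
      - fderiv ℝ (fderiv ℝ (chartMul I G)) (chartOne I G, chartOne I G) (v, 0) (0, w) := by
  rw [modelBracket_eq_lieBracket, lieBracket_eq]
  simp only [fderiv_chartField]
  rw [(eventually_chartField w).self_of_nhds, (eventually_chartField v).self_of_nhds]
  beta_reduce
  rw [fderiv_chartMul_chartOne_left, fderiv_chartMul_chartOne_left]

/-- The derivative of the adjoint representation is the Lie bracket. -/
theorem hasDerivAt_modelAd {γ : ℝ → G} (hγ : ContMDiff 𝓘(ℝ, ℝ) I ∞ γ) (h0 : γ 0 = 1) (v : E) :
    HasDerivAt (fun t => modelAd I (γ t) v)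
      (modelBracket I G (modelDeriv 𝓘(ℝ, ℝ) I γ 0 1) v) 0 := by
  have : IsManifold I 1 G := .of_le (n := ∞) (by simp)
  have hAd : DifferentiableAt ℝ (fun t => modelAd I (γ t)) 0 := by
    have hsm : ContMDiff (𝓘(ℝ, ℝ).prod I) I ∞
        (Function.uncurry fun t x => γ t * x * (γ t)⁻¹) :=
      ((hγ.comp contMDiff_fst).mul contMDiff_snd).mul (hγ.comp contMDiff_fst).inv
    have := contMDiffAt_modelDeriv_of_fixed (n₀ := (0 : ℝ)) (x₀ := (1 : G)) (y₀ := 1)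
      hsm.contMDiffAt (by simp)
    exact (this.mdifferentiableAt (by simp)).differentiableAt
  have hAdv : DifferentiableAt ℝ (fun t => modelAd I (γ t) v) 0 :=
    hAd.clm_apply (differentiableAt_const v)
  -- Differentiability is known, but not the value `c`. It is solved for by differentiating `dR_k
  -- (Ad_k v) = dL_k v` along `γ`.
  set c := deriv (fun t => modelAd I (γ t) v) 0 with hc
  have hAdd : HasDerivAt (fun t => modelAd I (γ t) v) c 0 := hAdv.hasDerivAt
  set w : E := modelDeriv 𝓘(ℝ, ℝ) I γ 0 1 with hw
  set D := fderiv ℝ (fderiv ℝ (chartMul I G)) (chartOne I G, chartOne I G) with hD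
  have hγd : MDifferentiableAt 𝓘(ℝ, ℝ) I γ 0 := hγ.mdifferentiable (by simp) 0
  have hφd : MDifferentiableAt I 𝓘(ℝ, E) (extChartAt I (1 : G)) (γ 0) := by
    rw [h0]
    exact (contMDiffAt_extChartAt_of_mem (by simp)).mdifferentiableAt (by simp)
  set y : ℝ → E := fun t => extChartAt I (1 : G) (γ t) with hy
  have hy0 : y 0 = chartOne I G := by simp [hy, h0, chartOne]
  have hyd : HasDerivAt y w 0 := by
    have h1 : DifferentiableAt ℝ y 0 :=
      (MDifferentiableAt.comp (0 : ℝ) hφd hγd).differentiableAt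
    have h2 := modelDeriv_comp_apply (I := 𝓘(ℝ, ℝ)) (0 : ℝ) hφd hγd 1
    rw [h0, modelDeriv_extChartAt_one, modelDeriv_eq_fderiv] at h2
    have h3 := h1.hasDerivAt
    rwa [← fderiv_apply_one_eq_deriv, show fderiv ℝ y 0 1 = w from h2] at h3
  have hcomp : ∀ᶠ t in nhds (0 : ℝ),
      fderiv ℝ (chartMul I G) (chartOne I G, y t) (modelAd I (γ t) v, 0)
        = fderiv ℝ (chartMul I G) (y t, chartOne I G) (0, v) := by
    have hcy : Filter.Tendsto y (nhds 0) (nhds (chartOne I G)) := hy0 ▸ hyd.continuousAt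
    have hcγ : Filter.Tendsto γ (nhds 0) (nhds 1) := h0 ▸ hγ.continuous.continuousAt
    filter_upwards [hcy.eventually eventually_fderiv_chartMul_modelAd,
      hcγ.eventually (extChartAt_source_mem_nhds (I := I) (1 : G))] with t ht hts
    have := ht v
    rwa [hy, (extChartAt I (1 : G)).left_inv hts] at this
  have hl : HasDerivAt (fun t => fderiv ℝ (chartMul I G) (y t, chartOne I G) (0, v))
      (D (w, 0) (0, v)) 0 := by
    have h1 : HasDerivAt (fun t => (y t, chartOne I G)) (w, (0 : E)) 0 :=
      hyd.prodMk (hasDerivAt_const _ _)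
    have h2 := HasFDerivAt.comp_hasDerivAt (l := fderiv ℝ (chartMul I G)) (l' := D) (0 : ℝ)
      (by rw [hy0]; exact hasFDerivAt_fderiv_chartMul) h1
    simpa using h2.clm_apply (hasDerivAt_const (0 : ℝ) ((0, v) : E × E))
  have hr : HasDerivAt
      (fun t => fderiv ℝ (chartMul I G) (chartOne I G, y t) (modelAd I (γ t) v, 0))
      (D (0, w) (v, 0) + c) 0 := by
    have h1 : HasDerivAt (fun t => (chartOne I G, y t)) ((0 : E), w) 0 :=
      (hasDerivAt_const _ _).prodMk hyd
    have h2 := HasFDerivAt.comp_hasDerivAt (l := fderiv ℝ (chartMul I G)) (l' := D) (0 : ℝ)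
      (by rw [hy0]; exact hasFDerivAt_fderiv_chartMul) h1
    have h3 := h2.clm_apply (hAdd.prodMk (hasDerivAt_const (0 : ℝ) (0 : E)))
    simp only [Function.comp_apply, hy0, h0, modelAd_one, fderiv_chartMul_chartOne_right] at h3
    exact h3
  -- The differentiated relation reads `D (0, w) (v, 0) + c = D (w, 0) (0, v)`; symmetry of the
  -- second derivative turns it into the formula for the bracket.
  have hsymm : D (0, w) (v, 0) = D (v, 0) (0, w) :=
    (contDiffAt_chartMul (I := I) (G := G)).isSymmSndFDerivAt (by simp; norm_cast) _ _
  have key := (hr.congr_of_eventuallyEq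
    (Filter.EventuallyEq.symm hcomp)).unique hl
  rw [modelBracket_eq]
  convert! hAdd using 1
  rw [eq_comm, eq_sub_iff_add_eq, ← hsymm, add_comm]
  exact key

end Boundaryless

end Bracket

/-! ### The projection to cosets, and invariance under `K` versus under `𝔨` -/

section Invariance

variable {E : Type*} [NormedAddCommGroup E] [NormedSpace ℝ E]
  {H : Type*} [TopologicalSpace H] {I : ModelWithCorners ℝ E H}
  {G : Type*} [TopologicalSpace G] [ChartedSpace H G] [Group G]
  {K : Subgroup G}
  {F : Type*} [NormedAddCommGroup F] [NormedSpace ℝ F]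
  {H' : Type*} [TopologicalSpace H'] {J : ModelWithCorners ℝ F H'}

omit [TopologicalSpace G] in
theorem cosetProj_eq_iff {a b : G} : cosetProj K a = cosetProj K b ↔ a * b⁻¹ ∈ K := by
  rw [cosetProj, cosetProj, eq_comm, Quotient.eq]
  exact QuotientGroup.rightRel_apply

omit [TopologicalSpace G] in
theorem cosetProj_mul_left {k : G} (hk : k ∈ K) (g : G) : cosetProj K (k * g) = cosetProj K g := by
  rw [cosetProj_eq_iff]
  simpa using hk

omit [TopologicalSpace G] in
theorem mem_of_cosetProj_eq_one {k : G} (h : cosetProj K k = cosetProj K 1) : k ∈ K := by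
  simpa using cosetProj_eq_iff.1 h

/-- Velocities at the identity of curves in `K` lie in the Lie algebra of `K`. -/
theorem modelDeriv_mem_lieAlgebraOf {γ : ℝ → G} (hγ : ContMDiff 𝓘(ℝ, ℝ) I ∞ γ) (h0 : γ 0 = 1)
    (hK : ∀ t, γ t ∈ K) :
    (modelDeriv 𝓘(ℝ, ℝ) I γ 0 1 : GroupLieAlgebra I G) ∈ lieAlgebraOf I K :=
  ⟨γ, hγ, h0, hK, rfl⟩

theorem exists_curve_of_mem_lieAlgebraOf {v : GroupLieAlgebra I G} (hv : v ∈ lieAlgebraOf I K) :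
    ∃ γ : ℝ → G, ContMDiff 𝓘(ℝ, ℝ) I ∞ γ ∧ γ 0 = 1 ∧ (∀ t, γ t ∈ K) ∧
      (v : E) = modelDeriv 𝓘(ℝ, ℝ) I γ 0 1 :=
  hv

section Projection

variable [LieGroup I ∞ G] [ChartedSpace H' (RightCosetSpace K)]

theorem modelDeriv_cosetProj_mul_left
    (hproj : MDifferentiable I J (cosetProj K)) {k : G} (hk : k ∈ K) (g : G) (v : E) :
    modelDeriv I J (cosetProj K) (k * g) (modelDeriv I I (fun x => k * x) g v)
      = modelDeriv I J (cosetProj K) g v := by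
  rw [← modelDeriv_comp_apply (I' := I) (f := fun x => k * x) g (hproj _)
    (mdifferentiable_mul_left _ _)]
  simp only [cosetProj_mul_left hk]

omit [LieGroup I ∞ G] in
theorem modelDeriv_cosetProj_of_mem_lieAlgebraOf
    (hproj : MDifferentiable I J (cosetProj K)) {v : GroupLieAlgebra I G}
    (hv : v ∈ lieAlgebraOf I K) : modelDeriv I J (cosetProj K) (1 : G) v = 0 := by
  obtain ⟨γ, hγ, h0, hK, hvγ⟩ := exists_curve_of_mem_lieAlgebraOf hv
  have h := modelDeriv_comp_apply (I := 𝓘(ℝ, ℝ)) (I' := I) (I'' := J) (g := cosetProj K) (f := γ)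
    0 (hproj _) (hγ.mdifferentiable (by simp) 0) 1
  have hc : (fun t => cosetProj K (γ t)) = fun _ => cosetProj K 1 := by
    ext t
    rw [cosetProj_eq_iff]
    simpa using hK t
  rw [hc, modelDeriv_const, h0, ← hvγ] at h
  exact h.symm

/-- The kernel of the differential of the projection at `g` is the Lie algebra of `K`, translated
to `g`. -/
theorem modelToIdentity_mem_lieAlgebraOf [I.Boundaryless]
    (hproj : Manifold.IsSubmersion I J ∞ (cosetProj K)) {g : G} {v : E}
    (hv : modelDeriv I J (cosetProj K) g v = 0) :
    (modelToIdentity I g v : GroupLieAlgebra I G) ∈ lieAlgebraOf I K := by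
  obtain ⟨γ, hγ, h0, hK, rfl⟩ := exists_fibre_curve_of_modelDeriv_eq_zero (hproj.isSubmersionAt g) hv
  have h := modelToIdentity_velocity (hγ.mdifferentiable (by simp) 0)
  rw [h0] at h
  rw [← h]
  -- A curve in the fibre `Kg`, translated on the right by `g⁻¹`, is a curve in `K` through `1`.
  refine modelDeriv_mem_lieAlgebraOf (γ := fun s => γ s * g⁻¹)
    ((contMDiff_mul_right (a := g⁻¹)).comp hγ) (by simp [h0]) fun t => ?_
  exact cosetProj_eq_iff.1 (hK t)

end Projection

section Adjoint

variable [I.Boundaryless] [LieGroup I ∞ G]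

omit [I.Boundaryless] in
theorem contMDiff_curve_shift {γ : ℝ → G} (hγ : ContMDiff 𝓘(ℝ, ℝ) I ∞ γ) (t : ℝ) :
    ContMDiff 𝓘(ℝ, ℝ) I ∞ (fun r => γ (t + r) * (γ t)⁻¹) :=
  (contMDiff_mul_right (a := (γ t)⁻¹)).comp
    (hγ.comp (contDiff_const.add contDiff_id).contMDiff)

/-- Writing `Ad_{γ(t+r)} = Ad_{γ(t+r) γ(t)⁻¹} ∘ Ad_{γ(t)}` reduces time `t` to time `0`. If `γ`
stays in `K`, so does the shifted curve, and its velocity lies in `𝔨`. -/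
theorem hasDerivAt_modelAd_curve {γ : ℝ → G} (hγ : ContMDiff 𝓘(ℝ, ℝ) I ∞ γ) (u : E) (t : ℝ) :
    HasDerivAt (fun s => modelAd I (γ s) u)
      (modelBracket I G (modelDeriv 𝓘(ℝ, ℝ) I (fun r => γ (t + r) * (γ t)⁻¹) 0 1)
        (modelAd I (γ t) u)) t := by
  have h := hasDerivAt_modelAd (contMDiff_curve_shift hγ t) (by simp) (modelAd I (γ t) u)
  simp only [← modelAd_mul, inv_mul_cancel_right] at h
  have h2 := HasDerivAt.comp_sub_const (f := fun r => modelAd I (γ (t + r)) u) t t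
    (by rw [sub_self]; exact h)
  simpa using h2

theorem hasDerivAt_form_modelAd (A : E →L[ℝ] E →L[ℝ] ℝ) {γ : ℝ → G}
    (hγ : ContMDiff 𝓘(ℝ, ℝ) I ∞ γ) (u v : E) (t : ℝ) :
    HasDerivAt (fun s => A (modelAd I (γ s) u) (modelAd I (γ s) v))
      (A (modelBracket I G (modelDeriv 𝓘(ℝ, ℝ) I (fun r => γ (t + r) * (γ t)⁻¹) 0 1)
        (modelAd I (γ t) u)) (modelAd I (γ t) v)
      + A (modelAd I (γ t) u)
        (modelBracket I G (modelDeriv 𝓘(ℝ, ℝ) I (fun r => γ (t + r) * (γ t)⁻¹) 0 1)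
        (modelAd I (γ t) v))) t :=
  (A.hasFDerivAt.comp_hasDerivAt t (hasDerivAt_modelAd_curve hγ u t)).clm_apply
    (hasDerivAt_modelAd_curve hγ v t)

/-- Invariance under the group implies invariance under its Lie algebra. -/
theorem IsGroupAdInvariant.isAdInvariant
    {A : GroupLieAlgebra I G →L[ℝ] GroupLieAlgebra I G →L[ℝ] ℝ} (hA : IsGroupAdInvariant A K) :
    IsAdInvariant A (lieAlgebraOf I K) := by
  intro w hw u v
  obtain ⟨γ, hγ, h0, hK, hwγ⟩ := exists_curve_of_mem_lieAlgebraOf hw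
  let A' : E →L[ℝ] E →L[ℝ] ℝ := A
  have hA' : ∀ k ∈ K, ∀ u v : E, A' (modelAd I k u) (modelAd I k v) = A' u v := hA
  have key : ∀ u v : E, A' u (modelBracket I G w v) = - A' (modelBracket I G w u) v := by
    intro u v
    have h := hasDerivAt_form_modelAd A' hγ u v 0
    simp only [hA' _ (hK _), zero_add, h0, inv_one, mul_one, modelAd_one] at h
    -- Invariance under `K` makes the form constant along `γ`, so the product-rule derivative at `0`
    -- vanishes.
    have h2 := (hasDerivAt_const (0 : ℝ) (A' u v)).unique h
    rw [hwγ]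
    linarith
  exact key u v

/-- Along a curve in `K`, forms invariant under the Lie algebra of `K` are invariant. -/
theorem IsAdInvariant.form_modelAd_curve
    {A : GroupLieAlgebra I G →L[ℝ] GroupLieAlgebra I G →L[ℝ] ℝ}
    (hA : IsAdInvariant A (lieAlgebraOf I K)) {γ : ℝ → G} (hγ : ContMDiff 𝓘(ℝ, ℝ) I ∞ γ)
    (h0 : γ 0 = 1) (hK : ∀ t, γ t ∈ K) (t : ℝ) (u v : GroupLieAlgebra I G) :
    A (Ad I (γ t) u) (Ad I (γ t) v) = A u v := by
  let A' : E →L[ℝ] E →L[ℝ] ℝ := A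
  have hA' : ∀ w : E, (w : GroupLieAlgebra I G) ∈ lieAlgebraOf I K → ∀ u v : E,
    A' u (modelBracket I G w v) = - A' (modelBracket I G w u) v := hA
  have key : ∀ u v : E, A' (modelAd I (γ t) u) (modelAd I (γ t) v) = A' u v := by
    intro u v
    have hd : ∀ s, HasDerivAt (fun s => A' (modelAd I (γ s) u) (modelAd I (γ s) v)) 0 s := by
      intro s
      have h := hasDerivAt_form_modelAd A' hγ u v s
      rwa [hA' _ (modelDeriv_mem_lieAlgebraOf (contMDiff_curve_shift hγ s) (by simp)
        fun r => K.mul_mem (hK _) (K.inv_mem (hK _))), add_neg_cancel] at h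
    have h := is_const_of_deriv_eq_zero (fun s => (hd s).differentiableAt)
      (fun s => (hd s).deriv) t 0
    simpa only [h0, modelAd_one] using h
  exact key u v

omit [I.Boundaryless] in
theorem Ad_mul (k l : G) (v : GroupLieAlgebra I G) : Ad I (k * l) v = Ad I k (Ad I l v) :=
  modelAd_mul (E := E) k l v

omit [I.Boundaryless] [LieGroup I ∞ G] in
theorem Ad_one (v : GroupLieAlgebra I G) : Ad I (1 : G) v = v :=
  modelAd_one (E := E) v

/-- The elements of `K` whose adjoint action preserves `A`. -/
def adStabilizer (A : GroupLieAlgebra I G →L[ℝ] GroupLieAlgebra I G →L[ℝ] ℝ) (K : Subgroup G) :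
    Subgroup K where
  carrier := {k | ∀ u v : GroupLieAlgebra I G, A (Ad I (k : G) u) (Ad I (k : G) v) = A u v}
  mul_mem' {k l} hk hl u v := by
    rw [Subgroup.coe_mul, Ad_mul, Ad_mul, hk, hl]
  one_mem' u v := by rw [Subgroup.coe_one, Ad_one, Ad_one]
  inv_mem' {k} hk u v := by
    rw [Subgroup.coe_inv, ← hk, ← Ad_mul, ← Ad_mul, mul_inv_cancel, Ad_one, Ad_one]

/-- If `K` is connected, invariance under its Lie algebra implies invariance under `K`. -/
theorem IsAdInvariant.isGroupAdInvariant [ChartedSpace H' (RightCosetSpace K)]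
    (hproj : Manifold.IsSubmersion I J ∞ (cosetProj K)) (hconn : IsConnected (K : Set G))
    {A : GroupLieAlgebra I G →L[ℝ] GroupLieAlgebra I G →L[ℝ] ℝ}
    (hA : IsAdInvariant A (lieAlgebraOf I K)) : IsGroupAdInvariant A K := by
  have : IsTopologicalGroup G := topologicalGroup_of_lieGroup I ∞
  have : ConnectedSpace K := isConnected_iff_connectedSpace.1 hconn
  -- `K` is the fibre of the projection through `1`, so its elements near `1` in the subspace
  -- topology are endpoints of smooth curves in `K` starting at `1`.
  have hnhds : (adStabilizer A K : Set K) ∈ nhds 1 := by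
    have h := (continuous_subtype_val (p := fun x => x ∈ K)).continuousAt (x := 1)|>.eventually
      (eventually_exists_fibre_curve (hproj.isSubmersionAt (1 : G)))
    filter_upwards [h] with k hk u v
    obtain ⟨γ, hγ, h0, h1, hK⟩ := hk (cosetProj_eq_iff.2 (by simp))
    rw [← h1]
    exact hA.form_modelAd_curve hγ h0 (fun t => mem_of_cosetProj_eq_one (hK t)) 1 u v
  have hopen : IsOpen (adStabilizer A K : Set K) := Subgroup.isOpen_of_mem_nhds _ hnhds
  have huniv : (adStabilizer A K : Set K) = Set.univ :=
    IsClopen.eq_univ ⟨Subgroup.isClosed_of_isOpen _ hopen, hopen⟩ ⟨1, one_mem _⟩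
  intro k hk
  have : (⟨k, hk⟩ : K) ∈ (adStabilizer A K : Set K) := huniv ▸ Set.mem_univ _
  exact this

end Adjoint

end Invariance

/-! ### Bilinear algebra and the descended form -/

section Descent

variable {E : Type*} [NormedAddCommGroup E] [NormedSpace ℝ E]
  {H : Type*} [TopologicalSpace H] {I : ModelWithCorners ℝ E H}
  {G : Type*} [TopologicalSpace G] [ChartedSpace H G] [Group G]
  {K : Subgroup G}
  {F : Type*} [NormedAddCommGroup F] [NormedSpace ℝ F]
  {H' : Type*} [TopologicalSpace H'] {J : ModelWithCorners ℝ F H'}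

/-- Two symmetric bilinear forms with the same quadratic form agree. -/
theorem symm_bilin_eq_of_diag_eq {A B : E →L[ℝ] E →L[ℝ] ℝ} (hA : ∀ u v, A u v = A v u)
    (hB : ∀ u v, B u v = B v u) (h : ∀ v, A v v = B v v) (u v : E) : A u v = B u v := by
  have h1 := h (u + v)
  simp only [map_add, add_apply] at h1
  have h2 := h u
  have h3 := h v
  have h4 := hA u v
  have h5 := hB u v
  linarith

/-- A symmetric nonnegative form annihilates its isotropic vectors. -/
theorem apply_eq_zero_of_nonneg {A : E →L[ℝ] E →L[ℝ] ℝ} (hA : ∀ u v, A u v = A v u)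
    (hnn : ∀ v, 0 ≤ A v v) {v : E} (hv : A v v = 0) : A v = 0 := by
  ext u
  -- As `A v v = 0`, the form at `u + t • v` is affine in `t`; being nonnegative for all `t`, it
  -- must have slope zero.
  have h : ∀ t : ℝ, 0 ≤ A u u + 2 * t * A v u := fun t => by
    have h1 := hnn (u + t • v)
    simp only [map_add, add_apply, map_smul, smul_apply,
      smul_eq_mul, hv] at h1
    linarith [hA u v, congrArg (t * ·) (hA u v)]
  by_contra hne
  have hne' : A v u ≠ 0 := hne
  -- At this `t` the affine function equals `-1`.
  have := h (-(A u u + 1) / (2 * A v u))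
  have h2 : 2 * (-(A u u + 1) / (2 * A v u)) * A v u = -(A u u + 1) := by
    field_simp
  linarith

theorem eventually_mdifferentiableAt {M N : Type*}
    [TopologicalSpace M] [ChartedSpace H M] [IsManifold I 1 M]
    [TopologicalSpace N] [ChartedSpace H' N] [IsManifold J 1 N] {s : N → M} {x₀ : N} (hs : ContMDiffAt J I ∞ s x₀) :
    ∀ᶠ x in nhds x₀, MDifferentiableAt J I s x := by
  have h : ContMDiffAt J I 1 s x₀ := hs.of_le (by simp)
  filter_upwards [(contMDiffAt_iff_contMDiffAt_nhds (by simp)).1 h] with x hx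
  exact hx.mdifferentiableAt (by simp)

theorem modelDeriv_proj_section {M N : Type*}
    [TopologicalSpace M] [ChartedSpace H M] [TopologicalSpace N] [ChartedSpace H' N]
    {p : M → N} {s : N → M} {x : N} (hp : MDifferentiable I J p) (hs : MDifferentiableAt J I s x)
    (hps : ∀ᶠ y in nhds x, p (s y) = y) (v : F) :
    modelDeriv I J p (s x) (modelDeriv J I s x v) = v := by
  rw [← modelDeriv_comp_apply x (hp _) hs, modelDeriv_congr (g := fun y => y) hps, modelDeriv_id,
    ContinuousLinearMap.id_apply]

/-- Smoothness of a field of bilinear forms pulled back by a field of linear maps that is smooth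
in charts. -/
theorem contMDiffAt_bilinearComp {N : Type*} [TopologicalSpace N] [ChartedSpace H' N]
    [IsManifold J ∞ N] (A : E →L[ℝ] E →L[ℝ] ℝ)
    (B : ∀ x : N, TangentSpace J x →L[ℝ] TangentSpace J x →L[ℝ] ℝ) (T : N → F →L[ℝ] E) {x₀ : N}
    (hB : ∀ᶠ x in nhds x₀, ∀ v w : F, B x v w = A (T x v) (T x w))
    (hT : haveI : IsManifold J 1 N := .of_le (n := ∞) (by simp)
      ContMDiffAt J 𝓘(ℝ, F →L[ℝ] E) ∞ (fun x => (T x).comp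
      ((tangentBundleCore J N).coordChange (achart H' x₀) (achart H' x) x)) x₀) :
    ContMDiffAt J (J.prod 𝓘(ℝ, F →L[ℝ] F →L[ℝ] ℝ)) ∞
      (fun x => Bundle.TotalSpace.mk' (F →L[ℝ] F →L[ℝ] ℝ)
        (E := fun x : N => TangentSpace J x →L[ℝ] TangentSpace J x →L[ℝ] ℝ)
        x (B x)) x₀ := by
  have : IsManifold J 1 N := .of_le (n := ∞) (by simp)
  rw [contMDiffAt_hom_bundle]
  refine ⟨contMDiffAt_id, ?_⟩
  -- Pullback is quadratic in `T`: it is assembled from compositions and the isometries that swap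
  -- arguments.
  have hsm : ContDiff ℝ ∞ (fun T : F →L[ℝ] E => A.bilinearComp T T) := by
    have hL₁ : ContDiff ℝ ∞ (fun S : F →L[ℝ] E →L[ℝ] ℝ => S.flip) :=
      LinearIsometryEquiv.contDiff (𝕜 := ℝ) (E := F →L[ℝ] E →L[ℝ] ℝ)
        (F := E →L[ℝ] F →L[ℝ] ℝ) (ContinuousLinearMap.flipₗᵢ ℝ F E ℝ)
    have hL₂ : ContDiff ℝ ∞ (fun S : F →L[ℝ] F →L[ℝ] ℝ => S.flip) :=
      LinearIsometryEquiv.contDiff (𝕜 := ℝ) (E := F →L[ℝ] F →L[ℝ] ℝ)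
        (F := F →L[ℝ] F →L[ℝ] ℝ) (ContinuousLinearMap.flipₗᵢ ℝ F F ℝ)
    have h0 : ContDiff ℝ ∞ (fun T : F →L[ℝ] E => A.comp T) := contDiff_const.clm_comp contDiff_id
    have h1 : ContDiff ℝ ∞ (fun T : F →L[ℝ] E => (A.comp T).flip) :=
      hL₁.comp h0
    have h2 : ContDiff ℝ ∞ (fun T : F →L[ℝ] E => (A.comp T).flip.comp T) :=
      h1.clm_comp contDiff_id
    exact hL₂.comp h2
  refine (hsm.contMDiff.contMDiffAt.comp x₀ hT).congr_of_eventuallyEq ?_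
  filter_upwards [hB, (chartAt H' x₀).open_source.mem_nhds (mem_chart_source H' x₀)] with x hx hxs
  ext v w
  -- In the trivialization at `x₀`, the form `B x` is precomposed in both arguments with the
  -- coordinate change, which is the factor accompanying `T x` in `hT`.
  have h := inCoordinates_apply_eq₂ (𝕜 := ℝ) (F₁ := F) (E₁ := (TangentSpace J : N → Type _))
    (F₂ := F) (E₂ := (TangentSpace J : N → Type _)) (F₃ := ℝ) (E₃ := Bundle.Trivial N ℝ)
    (x₀ := x₀) (x := x) (ϕ := B x) (v := v) (w := w) (by simpa using hxs) (by simpa using hxs)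
    (by simp)
  refine h.trans ?_
  have hs : ∀ u : F, (trivializationAt F (TangentSpace J : N → Type _) x₀).symm x u
      = (tangentBundleCore J N).coordChange (achart H' x₀) (achart H' x) x u := fun u => by
    rw [← TangentBundle.symmL_trivializationAt_eq_core hxs]
    exact (Bundle.Trivialization.symmL_apply _ (by simpa using hxs) u).symm
  rw [hs, hs]
  simp only [Bundle.Trivial.fiberBundle_trivializationAt', Bundle.Trivial.linearMapAt_trivialization,
    LinearMap.id_apply]
  exact hx _ _

variable [LieGroup I ∞ G] [ChartedSpace H' (RightCosetSpace K)]
  {A : GroupLieAlgebra I G →L[ℝ] GroupLieAlgebra I G →L[ℝ] ℝ}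

/-- A form that descends vanishes on the Lie algebra of `K` and is invariant under `K`. -/
theorem Descends.vanishesOn_and_isGroupAdInvariant [IsManifold J ∞ (RightCosetSpace K)]
    (hproj : MDifferentiable I J (cosetProj K)) (hsymm : ∀ u v, A u v = A v u)
    (h : Descends J K (rightInvariantForm A)) :
    VanishesOn A (lieAlgebraOf I K) ∧ IsGroupAdInvariant A K := by
  obtain ⟨B, -, -, hB⟩ := h
  let A' : E →L[ℝ] E →L[ℝ] ℝ := A
  let B' : RightCosetSpace K → F →L[ℝ] F →L[ℝ] ℝ := B
  have hB' : ∀ (g : G) (v : E), 1 / 2 * A' (modelToIdentity I g v) (modelToIdentity I g v)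
      = B' (cosetProj K g) (modelDeriv I J (cosetProj K) g v) (modelDeriv I J (cosetProj K) g v) :=
    hB
  constructor
  · intro v hv
    have h1 := hB' 1 v
    rw [modelDeriv_cosetProj_of_mem_lieAlgebraOf hproj hv, modelToIdentity_one, map_zero] at h1
    exact h1
  · intro k hk u v
    have hdiag : ∀ v : E, A' (modelAd I k v) (modelAd I k v) = A' v v := fun v => by
      -- Evaluated at `dL_k v`, the right-hand side is the same as at `v`, while the left-hand side
      -- sees `Ad_k v`.
      have h1 := hB' (k * 1) (modelDeriv I I (fun x => k * x) 1 v)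
      rw [modelDeriv_cosetProj_mul_left hproj hk, cosetProj_mul_left hk, ← hB' 1 v,
        modelToIdentity_mul_left, modelToIdentity_one] at h1
      simpa using h1
    exact symm_bilin_eq_of_diag_eq (A := A'.bilinearComp (modelAd I k) (modelAd I k)) (B := A')
      (fun u v => hsymm _ _) hsymm hdiag u v

/-- The pullback of `A` to `T_g G` only depends on the projections to `G/K`. -/
theorem form_modelToIdentity_eq [I.Boundaryless]
    (hproj : Manifold.IsSubmersion I J ∞ (cosetProj K)) {A : E →L[ℝ] E →L[ℝ] ℝ}
    (hsymm : ∀ u v, A u v = A v u)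
    (hker : ∀ v : E, (v : GroupLieAlgebra I G) ∈ lieAlgebraOf I K → A v = 0)
    (hinv : ∀ k ∈ K, ∀ u v : E, A (modelAd I k u) (modelAd I k v) = A u v)
    {g h : G} (hgh : cosetProj K h = cosetProj K g) {v w v' w' : E}
    (hv : modelDeriv I J (cosetProj K) h v' = modelDeriv I J (cosetProj K) g v)
    (hw : modelDeriv I J (cosetProj K) h w' = modelDeriv I J (cosetProj K) g w) :
    A (modelToIdentity I h v') (modelToIdentity I h w')
      = A (modelToIdentity I g v) (modelToIdentity I g w) := by
  obtain ⟨k, hk, rfl⟩ : ∃ k ∈ K, h = k * g := ⟨h * g⁻¹, cosetProj_eq_iff.1 hgh, by group⟩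
  have hd : MDifferentiable I J (cosetProj K) := hproj.contMDiff.mdifferentiable (by simp)
  -- The vectors `u'` and `dL_k u` have the same projection, so their difference, moved to the
  -- identity, lies in `𝔨` and is annihilated by `A`.
  have key : ∀ {u u' : E},
      modelDeriv I J (cosetProj K) (k * g) u' = modelDeriv I J (cosetProj K) g u →
      A (modelToIdentity I (k * g) u') = A (modelAd I k (modelToIdentity I g u)) := fun {u u'} hu => by
    rw [← sub_eq_zero, ← map_sub, ← modelToIdentity_mul_left, ← map_sub]
    refine hker _ (modelToIdentity_mem_lieAlgebraOf hproj ?_)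
    rw [map_sub, hu, modelDeriv_cosetProj_mul_left hd hk, sub_self]
  rw [key hv, hsymm, key hw, hsymm, hinv k hk]

/-- Forms that annihilate the Lie algebra of `K` and are invariant under `K` descend. -/
theorem descends_of_isGroupAdInvariant [I.Boundaryless] [J.Boundaryless]
    [IsManifold J ∞ (RightCosetSpace K)]
    (hproj : Manifold.IsSubmersion I J ∞ (cosetProj K))
    (hsymm : ∀ u v, A u v = A v u) (hker : ∀ v ∈ lieAlgebraOf I K, A v = 0)
    (hinv : IsGroupAdInvariant A K) :
    Descends J K (rightInvariantForm A) := by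
  let A' : E →L[ℝ] E →L[ℝ] ℝ := A
  have hd : MDifferentiable I J (cosetProj K) := hproj.contMDiff.mdifferentiable (by simp)
  have hout : ∀ x : RightCosetSpace K, cosetProj K (Quotient.out x) = x := Quotient.out_eq
  have hsec : ∀ x : RightCosetSpace K, ∃ s : RightCosetSpace K → G, ContMDiffAt J I ∞ s x ∧
      ∀ᶠ y in nhds x, cosetProj K (s y) = y := fun x => by
    obtain ⟨s, h1, -, h2⟩ := exists_local_section (hproj.isSubmersionAt (Quotient.out x))
    rw [hout] at h1 h2
    exact ⟨s, h1, h2⟩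
  choose s hs hps using hsec
  -- The derivative at `x` of the section `s y`, in the right trivialization. The differentiated map
  -- takes `x` to `1`, the fixed target point that `contMDiffAt_modelDeriv` asks for.
  let T : RightCosetSpace K → RightCosetSpace K → F →L[ℝ] E := fun y x =>
    modelDeriv J I (fun z => s y z * (s y x)⁻¹) x
  have hTeq : ∀ {y x}, MDifferentiableAt J I (s y) x → ∀ v,
      T y x v = modelToIdentity I (s y x) (modelDeriv J I (s y) x v) := fun {y x} hx v =>
    modelDeriv_comp_apply (I' := I) (g := fun z => z * (s y x)⁻¹) x
      (mdifferentiable_mul_right _ _) hx v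
  -- Each point uses its own section, and these need not vary smoothly with the point. By `hform`
  -- the value does not depend on the section, so near `x₀` the single section `s x₀` computes `B`.
  let B : RightCosetSpace K → F →L[ℝ] F →L[ℝ] ℝ := fun x =>
    ((1 / 2 : ℝ) • A').bilinearComp (T x x) (T x x)
  have hform : ∀ {y x : RightCosetSpace K} {g : G}, MDifferentiableAt J I (s y) x →
      (∀ᶠ z in nhds x, cosetProj K (s y z) = z) → cosetProj K g = x → ∀ {v w : E} {v' w' : F},
      modelDeriv I J (cosetProj K) g v = v' → modelDeriv I J (cosetProj K) g w = w' →
      A' (T y x v') (T y x w') = A' (modelToIdentity I g v) (modelToIdentity I g w) := by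
    intro y x g hx hpx hg v w v' w' hv hw
    rw [hTeq hx, hTeq hx]
    refine form_modelToIdentity_eq hproj hsymm hker hinv (hpx.self_of_nhds.trans hg.symm) ?_ ?_
    · rw [modelDeriv_proj_section hd hx hpx, hv]
    · rw [modelDeriv_proj_section hd hx hpx, hw]
  have : IsManifold J 1 (RightCosetSpace K) := .of_le (n := ∞) (by simp)
  have : IsManifold I 1 G := .of_le (n := ∞) (by simp)
  have hsd : ∀ x, MDifferentiableAt J I (s x) x := fun x => (hs x).mdifferentiableAt (by simp)
  refine ⟨B, fun x₀ => ?_, fun x v w => ?_, fun g v => ?_⟩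
  · refine contMDiffAt_bilinearComp ((1 / 2 : ℝ) • A') B (T x₀) ?_ ?_
    · filter_upwards [eventually_mdifferentiableAt (hs x₀), (hps x₀).eventually_nhds]
        with x hx hpx v w
      change (1 / 2 : ℝ) * A' (T x x v) (T x x w) = (1 / 2 : ℝ) * A' (T x₀ x v) (T x₀ x w)
      rw [hTeq hx, hTeq hx]
      congr 1
      exact hform (hsd x) (hps x) hpx.self_of_nhds (modelDeriv_proj_section hd hx hpx v)
        (modelDeriv_proj_section hd hx hpx w)
    · refine contMDiffAt_modelDeriv (I'' := J) (f := fun x z => s x₀ z * (s x₀ x)⁻¹)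
        (g := fun x => x) (y₀ := 1) ?_ contMDiffAt_id (by simp)
      have h1 : ContMDiffAt (J.prod J) I ∞ (fun p : RightCosetSpace K × RightCosetSpace K =>
          s x₀ p.1) (x₀, x₀) :=
        ContMDiffAt.comp (x := ((x₀, x₀) : RightCosetSpace K × RightCosetSpace K)) (hs x₀)
          contMDiffAt_fst
      have h2 : ContMDiffAt (J.prod J) I ∞ (fun p : RightCosetSpace K × RightCosetSpace K =>
          s x₀ p.2) (x₀, x₀) :=
        ContMDiffAt.comp (x := ((x₀, x₀) : RightCosetSpace K × RightCosetSpace K)) (hs x₀)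
          contMDiffAt_snd
      exact h2.mul h1.inv
  · change (1 / 2 : ℝ) * A' (T x x v) (T x x w) = (1 / 2 : ℝ) * A' (T x x w) (T x x v)
    congr 1
    exact hsymm _ _
  · change (1 / 2 : ℝ) * A' (modelToIdentity I g v) (modelToIdentity I g v)
      = (1 / 2 : ℝ) * A' (T (cosetProj K g) (cosetProj K g) _) (T (cosetProj K g) (cosetProj K g) _)
    congr 1
    exact (hform (hsd _) (hps _) rfl rfl rfl).symm

omit [LieGroup I ∞ G] in
/-- If `ker A = 𝔨` or the energy is nonnegative, vectors of `𝔨` are annihilated by `A` as soon as the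
energy vanishes on `𝔨`. -/
theorem apply_eq_zero_of_vanishesOn (hsymm : ∀ u v, A u v = A v u)
    (hker : {v | A v = 0} = lieAlgebraOf I K ∨ ∀ v, 0 ≤ energy A v)
    (hvan : VanishesOn A (lieAlgebraOf I K)) : ∀ v ∈ lieAlgebraOf I K, A v = 0 := by
  intro v hv
  rcases hker with h | h
  · have h1 : v ∈ {v | A v = 0} := h ▸ hv
    exact h1
  · let A' : E →L[ℝ] E →L[ℝ] ℝ := A
    have h' : ∀ v : E, 0 ≤ 1 / 2 * A' v v := h
    have hv' : 1 / 2 * A' v v = 0 := hvan v hv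
    exact apply_eq_zero_of_nonneg (A := A') hsymm (fun v => by linarith [h' v]) (by linarith)

end Descent

end CosetForm

theorem mainTheorem5
    {E : Type*} [NormedAddCommGroup E] [NormedSpace ℝ E] [CompleteSpace E]
    {H : Type*} [TopologicalSpace H] (I : ModelWithCorners ℝ E H) [I.Boundaryless]
    {G : Type*} [TopologicalSpace G] [ChartedSpace H G] [Group G] [LieGroup I ∞ G]
    (K : Subgroup G)
    {F : Type*} [NormedAddCommGroup F] [NormedSpace ℝ F]
    {H' : Type*} [TopologicalSpace H'] (J : ModelWithCorners ℝ F H') [J.Boundaryless]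
    [ChartedSpace H' (CosetForm.RightCosetSpace K)]
    [IsManifold J ∞ (CosetForm.RightCosetSpace K)]
    (hproj : Manifold.IsSubmersion I J ∞ (CosetForm.cosetProj K))
    (A : GroupLieAlgebra I G →L[ℝ] GroupLieAlgebra I G →L[ℝ] ℝ)
    (hsymm : ∀ u v, A u v = A v u)
    (hker : {v | A v = 0} = CosetForm.lieAlgebraOf I K ∨ ∀ v, 0 ≤ CosetForm.energy A v) :
    (CosetForm.Descends J K (CosetForm.rightInvariantForm A) →
      CosetForm.VanishesOn A (CosetForm.lieAlgebraOf I K) ∧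
        CosetForm.IsAdInvariant A (CosetForm.lieAlgebraOf I K)) ∧
    (IsConnected (K : Set G) →
      CosetForm.VanishesOn A (CosetForm.lieAlgebraOf I K) ∧
        CosetForm.IsAdInvariant A (CosetForm.lieAlgebraOf I K) →
      CosetForm.Descends J K (CosetForm.rightInvariantForm A)) ∧
    (CosetForm.Descends J K (CosetForm.rightInvariantForm A) ↔
      CosetForm.VanishesOn A (CosetForm.lieAlgebraOf I K) ∧
        CosetForm.IsGroupAdInvariant A K) := by
  have hd : MDifferentiable I J (CosetForm.cosetProj K) :=
    hproj.contMDiff.mdifferentiable (by simp)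
  have hvi := CosetForm.Descends.vanishesOn_and_isGroupAdInvariant (A := A) hd hsymm
  have hdesc : CosetForm.VanishesOn A (CosetForm.lieAlgebraOf I K) ∧
      CosetForm.IsGroupAdInvariant A K → CosetForm.Descends J K (CosetForm.rightInvariantForm A) :=
    fun h => CosetForm.descends_of_isGroupAdInvariant hproj hsymm
      (CosetForm.apply_eq_zero_of_vanishesOn hsymm hker h.1) h.2
  exact ⟨fun h => ⟨(hvi h).1, (hvi h).2.isAdInvariant⟩,
    fun hK h => hdesc ⟨h.1, h.2.isGroupAdInvariant hproj hK⟩, hvi, hdesc⟩
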